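/- Let $c$ be the Banach space of convergent real sequences $x=(x(1),x(2),\dots)$ with the supremum norm, and write $x(0)=\lim_{n\to\infty}x(n)$. Let $f=(f(1),f(2),\dots)\in\ell_1$ (real scalars) act on $c$ by $$f(x)=\sum_{n=0}^{\infty} f(n+1)\,x(n),$$ and let $W_f=\{x\in c : f(x)=0\}$. Let $\ell_1$ act on $W_f$ by $g(x)=\sum_{n=1}^{\infty} g(n)x(n)$ for $g\in\ell_1$, $x\in W_f$, and let $\sigma(\ell_1,W_f)$ be the coarsest topology on $\ell_1$ for which $g\mapsto g(x)$ is continuous for every $x\in W_f$. We say that $\ell_1$ has the $\sigma(\ell_1,W_f)$-fixed point property ($\sigma(\ell_1,W_f)$-FPP) if, for every nonempty, convex, $\sigma(\ell_1,W_f)$-compact set $C\subset\ell_1$, every map $T:C\to C$ with $\|T(x)-T(y)\|_{\ell_1}\le\|x-y\|_{\ell_1}$ for all $x,y\in C$ has a fixed point. Suppose that $\|f\|_{\ell_1}=1$, $\tfrac12\le|f(1)|<1$ and $|f(j)|<\tfrac12$ for every $j\ge2$. Then $\ell_1$ has the $\sigma(\ell_1,W_f)$-FPP if and only if one of the following conditions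 holds: 1. $|f(1)|>\tfrac12$; 2. $|f(1)|=\tfrac12$ and the set $\{n\ge 1 : f(1)f(n+1)\le0\}$ is finite. -/

import Mathlib

open Filter Topology
open scoped ENNReal NNReal

namespace WeakStarFPP

noncomputable section

/-- The real Banach space `ℓ₁`; the entry with index `n` is the `(n + 1)`-st entry of the sequence. -/
abbrev Ell1 : Type := lp (fun _ : ℕ => ℝ) 1

/-- The real Banach space `ℓ_∞`. -/
abbrev EllInfty : Type := lp (fun _ : ℕ => ℝ) ∞

/-- The space `c` of convergent real sequences with the supremum norm, as a subspace of `ℓ_∞`. -/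
def ConvSeq : Submodule ℝ EllInfty where
  carrier := {x | ∃ l : ℝ, Tendsto (fun n => x n) atTop (𝓝 l)}
  add_mem' := by
    rintro x y ⟨a, ha⟩ ⟨b, hb⟩
    exact ⟨a + b, ha.add hb⟩
  zero_mem' := ⟨0, tendsto_const_nhds⟩
  smul_mem' := by
    rintro r x ⟨a, ha⟩
    exact ⟨r * a, ha.const_mul r⟩

/-- The limit of a convergent sequence. -/
def seqLim (x : ConvSeq) : ℝ := limUnder atTop (fun n => x.1 n)

theorem tendsto_seqLim (x : ConvSeq) : Tendsto (fun n => x.1 n) atTop (𝓝 (seqLim x)) :=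
  tendsto_nhds_limUnder x.2

theorem summable_ell1 (g : Ell1) : Summable fun n => ‖g n‖ := by
  have h := (lp.memℓp g).summable (by simp)
  simpa using h

theorem summable_mul (g : ℕ → ℝ) (hg : Summable fun n => ‖g n‖) (x : EllInfty) :
    Summable fun n => g n * x n := by
  refine Summable.of_norm_bounded (hg.mul_right ‖x‖) fun n => ?_
  rw [norm_mul]
  exact mul_le_mul_of_nonneg_left (lp.norm_apply_le_norm (by simp) x n) (norm_nonneg _)

theorem summable_shift (f : Ell1) : Summable fun n => ‖f (n + 1)‖ :=
  (summable_nat_add_iff 1).2 (summable_ell1 f)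

/-- The functional on `c` given by `f ∈ ℓ₁`: the first entry of `f` multiplies the limit of `x`,
and the `(n + 1)`-st entry of `f` multiplies the `n`-th entry of `x`, for `n ≥ 1`. -/
def cFunctional (f : Ell1) : ConvSeq →ₗ[ℝ] ℝ where
  toFun x := f 0 * seqLim x + ∑' n, f (n + 1) * x.1 n
  map_add' x y := by
    have h : seqLim (x + y) = seqLim x + seqLim y :=
      tendsto_nhds_unique (tendsto_seqLim (x + y)) ((tendsto_seqLim x).add (tendsto_seqLim y))
    have hs : ∑' n, f (n + 1) * (x + y).1 n
        = ∑' n, f (n + 1) * x.1 n + ∑' n, f (n + 1) * y.1 n := by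
      rw [← (summable_mul _ (summable_shift f) x.1).tsum_add
        (summable_mul _ (summable_shift f) y.1)]
      exact tsum_congr fun n => mul_add _ _ _
    rw [h, hs]
    ring
  map_smul' r x := by
    have h : seqLim (r • x) = r * seqLim x :=
      tendsto_nhds_unique (tendsto_seqLim (r • x)) ((tendsto_seqLim x).const_mul r)
    have hs : ∑' n, f (n + 1) * (r • x).1 n = r * ∑' n, f (n + 1) * x.1 n := by
      rw [← tsum_mul_left]
      exact tsum_congr fun n => mul_left_comm _ _ _
    rw [h, hs, RingHom.id_apply, smul_eq_mul]
    ring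

/-- The hyperplane `W_f = {x ∈ c : f(x) = 0}`. -/
def W (f : Ell1) : Submodule ℝ ConvSeq := LinearMap.ker (cFunctional f)

/-- The dual action of `ℓ₁` on `W_f`: `g(x) = ∑ g(n) x(n)`. -/
def pairing (f : Ell1) : Ell1 →ₗ[ℝ] W f →ₗ[ℝ] ℝ :=
  LinearMap.mk₂ ℝ (fun g x => ∑' n, g n * x.1.1 n)
    (fun g h x => by
      rw [← (summable_mul _ (summable_ell1 g) x.1.1).tsum_add
        (summable_mul _ (summable_ell1 h) x.1.1)]
      exact tsum_congr fun n => add_mul _ _ _)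
    (fun r g x => by
      rw [smul_eq_mul, ← tsum_mul_left]
      exact tsum_congr fun n => mul_assoc _ _ _)
    (fun g x y => by
      rw [← (summable_mul _ (summable_ell1 g) x.1.1).tsum_add
        (summable_mul _ (summable_ell1 g) y.1.1)]
      exact tsum_congr fun n => mul_add _ _ _)
    (fun r g x => by
      rw [smul_eq_mul, ← tsum_mul_left]
      exact tsum_congr fun n => mul_left_comm _ _ _)

/-- The topology `σ(ℓ₁, W_f)`: the coarsest topology on `ℓ₁` for which `g ↦ g(x)` is continuous for
every `x ∈ W_f`. -/
@[reducible] def sigmaTopology (f : Ell1) : TopologicalSpace Ell1 :=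
  WeakBilin.instTopologicalSpace (pairing f)

/-- Every nonexpansive self-map of `C` has a fixed point. -/
def HasFPP {X : Type*} [NormedAddCommGroup X] (C : Set X) : Prop :=
  ∀ T : C → C, (∀ x y : C, ‖(T x : X) - T y‖ ≤ ‖(x : X) - y‖) → ∃ x : C, T x = x

/-- `ℓ₁` has the `σ(ℓ₁, W_f)`-fixed point property. -/
def HasSigmaFPP (f : Ell1) : Prop :=
  ∀ C : Set Ell1, C.Nonempty → Convex ℝ C → @IsCompact Ell1 (sigmaTopology f) C → HasFPP C

end

end WeakStarFPP

namespace WeakStarFPP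

noncomputable section

/-! Everything is governed by `e = basisLimit f`, the `σ(ℓ₁, W_f)`-limit of the standard basis. Its
norm is `(1 - |f 0|) / |f 0|`, which is below `1` when `|f 0| > 1 / 2` and equal to `1` when `|f 0|
= 1 / 2`; in the second case the signs of the entries of `e` decide.

Sufficiency (`exists_fixedPoint_of_minimal`): in a minimal invariant compact convex set `K`, take
approximate fixed points `x n`, with coordinatewise limit `z` and `σ`-limit `g` along an
ultrafilter. By `sigma_limit_eq`, `g = z + s • e`, where `s` is the limit of the sums of `x n - z`.
By `tendsto_norm_sub_sub_norm`, `T` does not increase the distance to `z`, so by minimality this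
distance is constant on `K`, equal to `|s| * ‖e‖`. If `s = 0`, then `K` is a point. If not, `|s| ≤
|s| * ‖e‖` excludes `‖e‖ < 1`, and equality in the triangle inequality gives `x n - z` the sign
pattern of `s • e`; if `e` is negative off a finite set, this contradicts the sign of `s`.

Necessity (`not_hasSigmaFPP`): if `‖e‖ = 1` and `e ≥ 0` along a subsequence, the convex
combinations, possibly infinite, of `e` and the corresponding basis vectors form a compact convex
set, on which a right shift that restores total mass one is nonexpansive without fixed points. -/

/-! ### Norm estimates in `ℓ₁` and completeness of `W_f`. -/

theorem abs_tsum_le_tsum_abs {φ : ℕ → ℝ} (h : Summable fun n => |φ n|) :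
    |∑' n, φ n| ≤ ∑' n, |φ n| := by
  simpa only [Real.norm_eq_abs] using norm_tsum_le_tsum_norm (f := φ) h

theorem Ell1.norm_eq_tsum (g : Ell1) : ‖g‖ = ∑' n, |g n| := by
  have h := lp.norm_eq_tsum_rpow (p := 1) (by simp) g
  simpa using h

theorem Ell1.summable_abs (g : Ell1) : Summable fun n => |g n| := summable_ell1 g

theorem Ell1.norm_eq_abs_add (f : Ell1) : ‖f‖ = |f 0| + ∑' n, |f (n + 1)| := by
  rw [Ell1.norm_eq_tsum, (Ell1.summable_abs f).tsum_eq_zero_add]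

theorem Ell1.summable (g : Ell1) : Summable fun n => g n := (summable_ell1 g).of_norm

theorem Ell1.abs_tsum_le (g : Ell1) : |∑' n, g n| ≤ ‖g‖ := by
  rw [Ell1.norm_eq_tsum]
  exact abs_tsum_le_tsum_abs (Ell1.summable_abs g)

/-- An absolutely summable sequence as an element of `ℓ₁`. -/
def Ell1.mk (u : ℕ → ℝ) (hu : Summable fun n => |u n|) : Ell1 :=
  ⟨u, memℓp_gen (by simpa using hu)⟩

@[simp] theorem Ell1.mk_apply (u : ℕ → ℝ) (hu : Summable fun n => |u n|) (n : ℕ) :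
    Ell1.mk u hu n = u n := rfl

theorem pairing_apply (f g : Ell1) (w : W f) : pairing f g w = ∑' n, g n * w.1.1 n := rfl

theorem abs_pairing_le (f g : Ell1) (w : W f) : |pairing f g w| ≤ ‖g‖ * ‖w‖ := by
  rw [pairing_apply, Ell1.norm_eq_tsum, ← tsum_mul_right, ← Real.norm_eq_abs]
  refine tsum_of_norm_bounded ((Ell1.summable_abs g).mul_right ‖w‖).hasSum fun n => ?_
  rw [norm_mul]
  exact mul_le_mul_of_nonneg_left (lp.norm_apply_le_norm (by simp) w.1.1 n) (norm_nonneg _)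

theorem continuous_pairing (f : Ell1) (w : W f) :
    @Continuous Ell1 ℝ (sigmaTopology f) _ fun g => pairing f g w :=
  WeakBilin.eval_continuous (pairing f) w

theorem abs_seqLim_le (x : ConvSeq) : |seqLim x| ≤ ‖x‖ :=
  le_of_tendsto (tendsto_seqLim x).abs
    (Eventually.of_forall fun n => lp.norm_apply_le_norm (by simp) x.1 n)

theorem abs_cFunctional_le (f : Ell1) (x : ConvSeq) : |cFunctional f x| ≤ ‖f‖ * ‖x‖ := by
  have hs : |∑' n, f (n + 1) * x.1 n| ≤ (∑' n, |f (n + 1)|) * ‖x‖ := by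
    rw [← tsum_mul_right, ← Real.norm_eq_abs]
    refine tsum_of_norm_bounded ((summable_shift f).mul_right ‖x‖).hasSum fun n => ?_
    rw [norm_mul]
    exact mul_le_mul_of_nonneg_left (lp.norm_apply_le_norm (by simp) x.1 n) (norm_nonneg _)
  calc |cFunctional f x| ≤ |f 0 * seqLim x| + |∑' n, f (n + 1) * x.1 n| := abs_add_le _ _
    _ ≤ |f 0| * ‖x‖ + (∑' n, |f (n + 1)|) * ‖x‖ := by
      rw [abs_mul]
      gcongr
      exact abs_seqLim_le x
    _ = ‖f‖ * ‖x‖ := by rw [Ell1.norm_eq_abs_add f]; ring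

theorem isClosed_convSeq : IsClosed (ConvSeq : Set EllInfty) := by
  refine isClosed_of_closure_subset fun x hx => ?_
  refine cauchySeq_tendsto_of_complete (Metric.cauchySeq_iff'.2 fun ε hε => ?_)
  obtain ⟨y, ⟨l, hl⟩, hxy⟩ := Metric.mem_closure_iff.1 hx (ε / 3) (by positivity)
  obtain ⟨N, hN⟩ := Metric.cauchySeq_iff'.1 hl.cauchySeq (ε / 3) (by positivity)
  have hd (n : ℕ) : dist (x n) (y n) < ε / 3 := by
    rw [dist_eq_norm] at hxy ⊢
    exact (lp.norm_apply_le_norm (by simp) (x - y) n).trans_lt hxy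
  refine ⟨N, fun n hn => ?_⟩
  have h1 := hd n
  have h2 := hd N
  rw [dist_comm] at h2
  have := dist_triangle4 (x n) (y n) (y N) (x N)
  linarith [hN n hn]

instance completeSpace_convSeq : CompleteSpace ConvSeq :=
  isClosed_convSeq.completeSpace_coe

/-- Completeness makes the uniform boundedness principle available on `W f`. -/
instance completeSpace_W (f : Ell1) : CompleteSpace (W f) := by
  let F : ConvSeq →L[ℝ] ℝ := (cFunctional f).mkContinuous ‖f‖ (abs_cFunctional_le f)
  have h : IsClosed (W f : Set ConvSeq) := F.isClosed_ker
  exact h.completeSpace_coe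

/-! ### The unit ball of `W_f` norms `ℓ₁`. -/

/-- The sequence in `c` which agrees with `a` below `N` and is equal to `t` from `N` on. -/
def stepSeq (a : ℕ → ℝ) (t : ℝ) (N : ℕ) (ha : ∀ n, |a n| ≤ 1) (ht : |t| ≤ 1) : ConvSeq :=
  ⟨⟨fun n => if n < N then a n else t, memℓp_infty ⟨1, by
    rintro _ ⟨n, rfl⟩
    by_cases h : n < N
    · simpa [h] using ha n
    · simpa [h] using ht⟩⟩, t, tendsto_const_nhds.congr' (by
      filter_upwards [eventually_ge_atTop N] with n hn
      exact (if_neg (Nat.not_lt.2 hn)).symm)⟩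

section stepSeq

variable {a : ℕ → ℝ} {t : ℝ} {N : ℕ} (ha : ∀ n, |a n| ≤ 1) (ht : |t| ≤ 1)

theorem stepSeq_apply (n : ℕ) : (stepSeq a t N ha ht).1 n = if n < N then a n else t := rfl

theorem seqLim_stepSeq : seqLim (stepSeq a t N ha ht) = t :=
  tendsto_nhds_unique (tendsto_seqLim _) (tendsto_const_nhds.congr' (by
    filter_upwards [eventually_ge_atTop N] with n hn
    rw [stepSeq_apply, if_neg (Nat.not_lt.2 hn)]))

theorem norm_stepSeq_le : ‖stepSeq a t N ha ht‖ ≤ 1 := by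
  have h (n : ℕ) : ‖(stepSeq a t N ha ht).1 n‖ ≤ 1 := by
    rw [stepSeq_apply]
    split_ifs
    exacts [ha n, ht]
  exact lp.norm_le_of_forall_le zero_le_one h

theorem tsum_mul_stepSeq (v : ℕ → ℝ) (hv : Summable fun n => ‖v n‖) :
    ∑' n, v n * (stepSeq a t N ha ht).1 n =
      ∑ k ∈ Finset.range N, v k * a k + (∑' k, v (k + N)) * t := by
  rw [← (summable_mul v hv (stepSeq a t N ha ht).1).sum_add_tsum_nat_add N, ← tsum_mul_right]
  congr 1
  · refine Finset.sum_congr rfl fun k hk => ?_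
    rw [stepSeq_apply, if_pos (Finset.mem_range.1 hk)]
  · refine tsum_congr fun k => ?_
    rw [stepSeq_apply, if_neg (by lia)]

end stepSeq

/-- The value which a sequence with given first entries has to take from `N` on to be annihilated
by a functional whose mass at the limit is at least one half of its norm. -/
theorem exists_step_value {c : ℝ} {φ : ℕ → ℝ} (hφ : Summable fun k => |φ k|)
    (hcφ : |c| + ∑' k, |φ k| = 1) (hc : 1 / 2 ≤ |c|) {N : ℕ} (hN : ∑' k, |φ (k + N)| < 1 / 2)
    {a : ℕ → ℝ} (ha : ∀ n, |a n| ≤ 1) : ∃ t : ℝ, |t| ≤ 1 ∧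
      c * t + (∑ k ∈ Finset.range N, φ k * a k + (∑' k, φ (k + N)) * t) = 0 := by
  have h1 := hφ.sum_add_tsum_nat_add N
  have hA : |∑ k ∈ Finset.range N, φ k * a k| ≤ ∑ k ∈ Finset.range N, |φ k| := by
    refine (Finset.abs_sum_le_sum_abs _ _).trans (Finset.sum_le_sum fun k _ => ?_)
    rw [abs_mul]
    exact mul_le_of_le_one_right (abs_nonneg _) (ha _)
  have hB : |∑' k, φ (k + N)| ≤ ∑' k, |φ (k + N)| :=
    abs_tsum_le_tsum_abs ((summable_nat_add_iff (f := fun k => |φ k|) N).2 hφ)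
  generalize ∑ k ∈ Finset.range N, φ k * a k = A at *
  generalize ∑' k, φ (k + N) = B at *
  -- Head and tail satisfy `|A| + |B| ≤ 1 - |c| ≤ |c|`, so `|A| ≤ |c + B|`; the strict tail bound
  -- gives `c + B ≠ 0`.
  have hden := abs_sub_abs_le_abs_sub c (-B)
  rw [abs_neg, sub_neg_eq_add] at hden
  have hpos : 0 < |c + B| := by linarith
  refine ⟨-A / (c + B), ?_, ?_⟩
  · rw [abs_div, abs_neg, div_le_one hpos]
    linarith
  · linear_combination div_mul_cancel₀ (-A) (abs_pos.1 hpos)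

/-- For `‖f‖ = 1` and `|f 0| ≥ 1 / 2` the unit ball of `W f` norms `ℓ₁`. -/
theorem exists_W_norming (f : Ell1) (hf : ‖f‖ = 1) (hf0 : 1 / 2 ≤ |f 0|) (g : Ell1) {ε : ℝ}
    (hε : 0 < ε) : ∃ w : W f, ‖w‖ ≤ 1 ∧ ‖g‖ - ε ≤ pairing f g w := by
  obtain ⟨N, hNf, hNg⟩ : ∃ N, ∑' k, |f (k + N + 1)| < 1 / 2 ∧ ∑' k, |g (k + N)| < ε / 2 :=
    (((tendsto_order.1 (tendsto_sum_nat_add fun k => |f (k + 1)|)).2 (1 / 2) (by norm_num)).and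
      ((tendsto_order.1 (tendsto_sum_nat_add fun k => |g k|)).2 (ε / 2) (by positivity))).exists
  -- The test sequence is the sign of `g` below `N`; the constant value after `N` puts it in `W f`
  -- and costs less than `ε` in the pairing.
  have ha (n : ℕ) : |(SignType.sign (g n) : ℝ)| ≤ 1 := by
    rcases lt_trichotomy (g n) 0 with h | h | h <;> simp [h]
  obtain ⟨t, ht, hteq⟩ := exists_step_value (φ := fun k => f (k + 1)) (summable_shift f)
    ((Ell1.norm_eq_abs_add f).symm.trans hf) hf0 hNf ha
  have hyW : stepSeq _ t N ha ht ∈ W f := by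
    change f 0 * seqLim (stepSeq _ t N ha ht) + ∑' n, f (n + 1) * (stepSeq _ t N ha ht).1 n = 0
    rw [seqLim_stepSeq, tsum_mul_stepSeq _ _ (fun n => f (n + 1)) (summable_shift f)]
    exact hteq
  refine ⟨⟨_, hyW⟩, norm_stepSeq_le ha ht, ?_⟩
  rw [pairing_apply, tsum_mul_stepSeq ha ht _ (summable_ell1 g), Ell1.norm_eq_tsum,
    ← (Ell1.summable_abs g).sum_add_tsum_nat_add N,
    Finset.sum_congr rfl fun k _ => self_mul_sign (g k)]
  have h2 : |(∑' k, g (k + N)) * t| ≤ ∑' k, |g (k + N)| := by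
    rw [abs_mul]
    exact (mul_le_of_le_one_right (abs_nonneg _) ht).trans (abs_tsum_le_tsum_abs
      ((summable_nat_add_iff (f := fun k => |g k|) N).2 (Ell1.summable_abs g)))
  have := neg_abs_le ((∑' k, g (k + N)) * t)
  linarith

theorem eq_of_pairing_eq (f : Ell1) (hf : ‖f‖ = 1) (hf0 : 1 / 2 ≤ |f 0|) {g h : Ell1}
    (hgh : ∀ w, pairing f g w = pairing f h w) : g = h := by
  rw [← sub_eq_zero, ← norm_le_zero_iff]
  refine le_of_forall_pos_le_add fun ε hε => ?_
  obtain ⟨w, -, hw⟩ := exists_W_norming f hf hf0 (g - h) hε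
  rw [map_sub, LinearMap.sub_apply, hgh w] at hw
  linarith

/-! ### Separation, closed balls and boundedness for `σ(ℓ₁, W_f)`. -/

theorem t2Space_sigmaTopology (f : Ell1) (hf : ‖f‖ = 1) (hf0 : 1 / 2 ≤ |f 0|) :
    @T2Space Ell1 (sigmaTopology f) := by
  refine @T2Space.mk Ell1 (sigmaTopology f) fun g h hgh => ?_
  obtain ⟨w, hw⟩ : ∃ w, pairing f g w ≠ pairing f h w := by
    by_contra! hcon
    exact hgh (eq_of_pairing_eq f hf hf0 hcon)
  exact @separated_by_continuous _ _ (sigmaTopology f) _ _ _ (continuous_pairing f w) _ _ hw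

/-- Norm balls are `σ(ℓ₁, W_f)`-closed. -/
theorem isClosed_sigma_closedBall (f : Ell1) (hf : ‖f‖ = 1) (hf0 : 1 / 2 ≤ |f 0|) (z : Ell1)
    (r : ℝ) : @IsClosed Ell1 (sigmaTopology f) {y | ‖z - y‖ ≤ r} := by
  let _ := sigmaTopology f
  have h : {y : Ell1 | ‖z - y‖ ≤ r} =
      ⋂ w : {w : W f // ‖w‖ ≤ 1}, {y : Ell1 | pairing f z w.1 - pairing f y w.1 ≤ r} := by
    ext y
    simp only [Set.mem_ofPred_eq, Set.mem_iInter]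
    constructor
    · rintro hy ⟨w, hw⟩
      have h1 := abs_pairing_le f (z - y) w
      rw [map_sub, LinearMap.sub_apply] at h1
      have h2 := mul_le_of_le_one_right (norm_nonneg (z - y)) hw
      linarith [le_abs_self (pairing f z w - pairing f y w)]
    · intro hy
      refine le_of_forall_pos_le_add fun ε hε => ?_
      obtain ⟨w, hw1, hw⟩ := exists_W_norming f hf hf0 (z - y) hε
      rw [map_sub, LinearMap.sub_apply] at hw
      linarith [hy ⟨w, hw1⟩]
  rw [h]
  exact isClosed_iInter fun w =>
    isClosed_le (continuous_const.sub (continuous_pairing f w.1)) continuous_const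

/-- A pointwise bounded family of bounded functionals on a Banach space is uniformly bounded. -/
theorem exists_uniform_bound {ι E : Type*} [NormedAddCommGroup E] [NormedSpace ℝ E]
    [CompleteSpace E] (P : ι → E →ₗ[ℝ] ℝ) (b : ι → ℝ) (hb : ∀ i x, |P i x| ≤ b i * ‖x‖)
    (h : ∀ x, ∃ c, ∀ i, |P i x| ≤ c) : ∃ M, ∀ i x, |P i x| ≤ M * ‖x‖ := by
  obtain ⟨M, hM⟩ := banach_steinhaus (g := fun i => (P i).mkContinuous (b i) (hb i)) h
  exact ⟨M, fun i x => ((P i).mkContinuous (b i) (hb i)).le_of_opNorm_le (hM i) x⟩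

/-- Evaluations at `w` are bounded on a compact set, so Banach–Steinhaus bounds the functionals
uniformly; norming by `W f` turns this into a bound in `ℓ₁`. -/
theorem exists_norm_le_of_isCompact (f : Ell1) (hf : ‖f‖ = 1) (hf0 : 1 / 2 ≤ |f 0|) {C : Set Ell1}
    (hC : @IsCompact Ell1 (sigmaTopology f) C) : ∃ M, ∀ g ∈ C, ‖g‖ ≤ M := by
  obtain ⟨M, hM⟩ : ∃ M, ∀ (g : C) (w : W f), |pairing f g w| ≤ M * ‖w‖ := by
    refine @exists_uniform_bound C (W f) _ (Submodule.normedSpace (W f)) _ (fun g => pairing f g)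
      (fun g => ‖(g : Ell1)‖) (fun g => abs_pairing_le f g) fun w => ?_
    obtain ⟨b, hb⟩ := (@IsCompact.image _ _ (sigmaTopology f) _ _ _ hC
      (continuous_pairing f w)).isBounded.exists_norm_le
    exact ⟨b, fun g => hb _ ⟨g, g.2, rfl⟩⟩
  refine ⟨|M|, fun g hg => le_of_forall_pos_le_add fun ε hε => ?_⟩
  obtain ⟨w, hw1, hw⟩ := exists_W_norming f hf hf0 g hε
  have h1 := hM ⟨g, hg⟩ w
  have h2 := mul_le_of_le_one_right (abs_nonneg M) hw1
  have h3 := mul_le_mul_of_nonneg_right (le_abs_self M) (norm_nonneg w)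
  linarith [le_abs_self (pairing f g w)]

/-! ### The limit of the standard basis. -/

/-- The `σ(ℓ₁, W_f)`-limit of the standard basis of `ℓ₁`. -/
def basisLimit (f : Ell1) : Ell1 :=
  Ell1.mk (fun n => -f (n + 1) / f 0) (by
    simpa only [abs_div, abs_neg] using
      (show Summable fun n => |f (n + 1)| from summable_shift f).div_const |f 0|)

theorem basisLimit_apply (f : Ell1) (n : ℕ) : basisLimit f n = -f (n + 1) / f 0 := rfl

theorem norm_basisLimit (f : Ell1) (hf : ‖f‖ = 1) : ‖basisLimit f‖ = (1 - |f 0|) / |f 0| := by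
  have h2 := Ell1.norm_eq_abs_add f
  simp only [Ell1.norm_eq_tsum (basisLimit f), basisLimit_apply, abs_div, abs_neg, tsum_div_const]
  congr 1
  linarith

/-- The equation `f(w) = 0` expresses the limit of `w` through its entries. As the `n`-th basis
vector pairs to the `n`-th entry of `w`, this identifies the limit of the basis. -/
theorem pairing_basisLimit (f : Ell1) (hf0 : f 0 ≠ 0) (w : W f) :
    pairing f (basisLimit f) w = seqLim w.1 := by
  have hw : f 0 * seqLim w.1 + ∑' n, f (n + 1) * w.1.1 n = 0 := w.2
  have h : pairing f (basisLimit f) w = (-1 / f 0) * ∑' n, f (n + 1) * w.1.1 n := by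
    rw [pairing_apply, ← tsum_mul_left]
    refine tsum_congr fun n => ?_
    rw [basisLimit_apply]
    ring
  rw [h, eq_neg_of_add_eq_zero_right hw]
  field_simp

theorem basisLimit_nonneg_iff (f : Ell1) (hf0 : f 0 ≠ 0) (n : ℕ) :
    0 ≤ basisLimit f n ↔ f 0 * f (n + 1) ≤ 0 := by
  have h : basisLimit f n = -(f 0 * f (n + 1)) / (f 0) ^ 2 := by
    rw [basisLimit_apply]
    field_simp
  have h2 : 0 < (f 0) ^ 2 := by positivity
  rw [h, le_div_iff₀ h2, zero_mul, neg_nonneg]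

/-! ### Minimal invariant sets and approximate fixed points. -/

theorem exists_minimal_invariant {X : Type*} [AddCommGroup X] [Module ℝ X] [TopologicalSpace X]
    [T2Space X] {C : Set X} (hne : C.Nonempty) (hconv : Convex ℝ C) (hC : IsCompact C) {T : X → X}
    (hT : Set.MapsTo T C C) :
    ∃ K ⊆ C, K.Nonempty ∧ IsCompact K ∧ Convex ℝ K ∧ Set.MapsTo T K K ∧
      ∀ K' ⊆ K, K'.Nonempty → IsClosed K' → Convex ℝ K' → Set.MapsTo T K' K' → K' = K := by
  let S : Set (Set X) :=
    {K | K ⊆ C ∧ K.Nonempty ∧ IsClosed K ∧ Convex ℝ K ∧ Set.MapsTo T K K}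
  obtain ⟨K, ⟨hKC, hKne, hKcl, hKconv, hKT⟩, hmin⟩ : ∃ K, Minimal (· ∈ S) K := by
    refine zorn_superset S fun c hcS hc => ?_
    rcases c.eq_empty_or_nonempty with rfl | hcne
    · exact ⟨C, ⟨subset_rfl, hne, hC.isClosed, hconv, hT⟩, by simp⟩
    · have : Nonempty c := hcne.to_subtype
      obtain ⟨K₀, hK₀⟩ := hcne
      refine ⟨⋂₀ c, ⟨(Set.sInter_subset_of_mem hK₀).trans (hcS hK₀).1, ?_,
        isClosed_sInter fun K hK => (hcS hK).2.2.1, convex_sInter fun K hK => (hcS hK).2.2.2.1,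
        fun x hx K hK => (hcS hK).2.2.2.2 (hx K hK)⟩, fun K hK => Set.sInter_subset_of_mem hK⟩
      exact IsCompact.nonempty_sInter_of_directed_nonempty_isCompact_isClosed
        (fun A hA B hB => (hc.total hA hB).elim (fun h => ⟨A, hA, subset_rfl, h⟩)
          fun h => ⟨B, hB, h, subset_rfl⟩)
        (fun K hK => (hcS hK).2.1)
        (fun K hK => hC.of_isClosed_subset (hcS hK).2.2.1 (hcS hK).1) fun K hK => (hcS hK).2.2.1
  refine ⟨K, hKC, hKne, hC.of_isClosed_subset hKcl hKC, hKconv, hKT,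
    fun K' hK' hne' hcl' hconv' hT' => hK'.antisymm ?_⟩
  exact hmin ⟨hK'.trans hKC, hne', hcl', hconv', hT'⟩ hK'

/-- Mixing a little of `x₀` into `T` gives a strict contraction, whose successive iterates get
close. Stopping at a finite iterate avoids any completeness of `K`. -/
theorem exists_approx_fixedPoint {X : Type*} [NormedAddCommGroup X] [NormedSpace ℝ X] {K : Set X}
    (hne : K.Nonempty) (hconv : Convex ℝ K) {M : ℝ} (hM : ∀ x ∈ K, ‖x‖ ≤ M) {T : X → X}
    (hT : Set.MapsTo T K K) (hTn : ∀ x ∈ K, ∀ y ∈ K, ‖T x - T y‖ ≤ ‖x - y‖) {ε : ℝ} (hε : 0 < ε) :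
    ∃ x ∈ K, ‖x - T x‖ ≤ ε := by
  obtain ⟨x₀, hx₀⟩ := hne
  have hM0 : 0 ≤ M := (norm_nonneg _).trans (hM x₀ hx₀)
  have hdiam {x y : X} (hx : x ∈ K) (hy : y ∈ K) : ‖x - y‖ ≤ 2 * M := by
    linarith [norm_sub_le x y, hM x hx, hM y hy]
  -- Small enough that the perturbation, at most `δ` times the diameter, is within `ε / 2`; the `+
  -- 1` covers `M = 0`.
  set δ := min (1 / 2) (ε / 2 / (2 * M + 1)) with hδ
  have hδ0 : 0 < δ := by positivity
  have hδ1 : δ ≤ 1 / 2 := min_le_left _ _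
  have hδM : δ * (2 * M) ≤ ε / 2 := by
    have h := (le_div_iff₀ (by positivity)).1 (min_le_right (1 / 2) (ε / 2 / (2 * M + 1)))
    rw [← hδ] at h
    linarith
  let S (x : X) : X := δ • x₀ + (1 - δ) • T x
  have hS : Set.MapsTo S K K := fun x hx =>
    hconv hx₀ (hT hx) hδ0.le (by linarith) (by ring)
  have hu (n : ℕ) : S^[n] x₀ ∈ K := hS.iterate n hx₀
  have hstep (n : ℕ) : ‖S^[n] x₀ - S^[n + 1] x₀‖ ≤ (1 - δ) ^ n * (2 * M) := by
    induction n with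
    | zero => simpa using hdiam hx₀ (hS hx₀)
    | succ n ih =>
      have h : S^[n + 1] x₀ - S^[n + 1 + 1] x₀ =
          (1 - δ) • (T (S^[n] x₀) - T (S^[n + 1] x₀)) := by
        rw [Function.iterate_succ_apply' S (n + 1), Function.iterate_succ_apply' S n]
        simp only [S]
        module
      rw [h, norm_smul, Real.norm_of_nonneg (by linarith), pow_succ', mul_assoc]
      exact mul_le_mul_of_nonneg_left ((hTn _ (hu n) _ (hu (n + 1))).trans ih) (by linarith)
  obtain ⟨n, hn⟩ : ∃ n, (1 - δ) ^ n * (2 * M) ≤ ε / 2 := by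
    have h := (tendsto_pow_atTop_nhds_zero_of_lt_one (r := 1 - δ) (by linarith)
      (by linarith)).mul_const (2 * M)
    rw [zero_mul] at h
    exact (h.eventually (ge_mem_nhds (by positivity))).exists
  refine ⟨_, hu n, ?_⟩
  have h1 : ‖S^[n + 1] x₀ - T (S^[n] x₀)‖ ≤ δ * (2 * M) := by
    have h : S^[n + 1] x₀ - T (S^[n] x₀) = δ • (x₀ - T (S^[n] x₀)) := by
      rw [Function.iterate_succ_apply' S n]
      simp only [S]
      module
    rw [h, norm_smul, Real.norm_of_nonneg hδ0.le]
    exact mul_le_mul_of_nonneg_left (hdiam hx₀ (hT (hu n))) hδ0.le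
  linarith [norm_sub_le_norm_sub_add_norm_sub (S^[n] x₀) (S^[n + 1] x₀) (T (S^[n] x₀)), hstep n]

/-! ### Coordinatewise limits in `ℓ₁`. -/

theorem exists_tendsto_of_abs_le {ι : Type*} (U : Ultrafilter ι) {a : ι → ℝ} {M : ℝ}
    (h : ∀ i, |a i| ≤ M) : ∃ l, Tendsto a U (𝓝 l) := by
  obtain ⟨l, -, hl⟩ := isCompact_Icc.ultrafilter_le_nhds (U.map a) (s := Set.Icc (-M) M)
    (by
      rw [Ultrafilter.coe_map, le_principal_iff]
      exact Filter.mem_map.2 (univ_mem' fun i => abs_le.1 (h i)))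
  exact ⟨l, hl⟩

/-- If `y` tends to zero coordinatewise then `‖y - v‖ - ‖y‖` tends to `‖v‖`. -/
theorem tendsto_norm_sub_sub_norm {ι : Type*} {F : Filter ι} {y : ι → Ell1}
    (hy : ∀ k, Tendsto (fun i => y i k) F (𝓝 0)) (v : Ell1) :
    Tendsto (fun i => ‖y i - v‖ - ‖y i‖) F (𝓝 ‖v‖) := by
  have heq (i : ι) : ‖y i - v‖ - ‖y i‖ = ∑' k, (|y i k - v k| - |y i k|) := by
    rw [Ell1.norm_eq_tsum, Ell1.norm_eq_tsum,
      ← (Ell1.summable_abs (y i - v)).tsum_sub (Ell1.summable_abs (y i))]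
    rfl
  simp only [heq, Ell1.norm_eq_tsum v]
  refine tendsto_tsum_of_dominated_convergence (Ell1.summable_abs v) (fun k => ?_)
    (Eventually.of_forall fun i k => ?_)
  · have := (((hy k).sub_const (v k)).abs).sub (hy k).abs
    simpa using this
  · rw [Real.norm_eq_abs]
    refine (abs_abs_sub_abs_le_abs_sub _ _).trans (le_of_eq ?_)
    rw [sub_sub_cancel_left, abs_neg]

/-- A bounded family in `ℓ₁` tending to zero coordinatewise tends to zero on null sequences. -/
theorem tendsto_tsum_mul_zero {ι : Type*} {F : Filter ι} {y : ι → Ell1} {M : ℝ}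
    (hM : ∀ i, ‖y i‖ ≤ M) (hy : ∀ k, Tendsto (fun i => y i k) F (𝓝 0)) {u : ℕ → ℝ}
    (hu : Tendsto u atTop (𝓝 0)) : Tendsto (fun i => ∑' k, y i k * u k) F (𝓝 0) := by
  rw [Metric.tendsto_nhds]
  intro ε hε
  obtain ⟨N, hN⟩ := eventually_atTop.1
    (Metric.tendsto_nhds.1 hu (ε / (2 * (|M| + 1))) (by positivity))
  obtain ⟨B, hB⟩ := hu.abs.bddAbove_range
  have hB' (k : ℕ) : |u k| ≤ B := hB ⟨k, rfl⟩
  have hhead : Tendsto (fun i => ∑ k ∈ Finset.range N, y i k * u k) F (𝓝 0) := by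
    simpa using tendsto_finsetSum (Finset.range N) fun k _ => (hy k).mul_const (u k)
  filter_upwards [Metric.tendsto_nhds.1 hhead (ε / 2) (by positivity)] with i hi
  have hs : Summable fun k => |y i k * u k| := by
    refine ((Ell1.summable_abs (y i)).mul_right B).of_nonneg_of_le (fun _ => abs_nonneg _) ?_
    intro k
    rw [abs_mul]
    exact mul_le_mul_of_nonneg_left (hB' k) (abs_nonneg _)
  have hs' : Summable fun k => |y i (k + N) * u (k + N)| :=
    (summable_nat_add_iff (f := fun k => |y i k * u k|) N).2 hs
  have hyN := (summable_nat_add_iff (f := fun k => |y i k|) N).2 (Ell1.summable_abs (y i))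
  have htail : |∑' k, y i (k + N) * u (k + N)| ≤ ε / 2 := by
    calc |∑' k, y i (k + N) * u (k + N)| ≤ ∑' k, |y i (k + N) * u (k + N)| :=
          abs_tsum_le_tsum_abs hs'
      _ ≤ ∑' k, |y i (k + N)| * (ε / (2 * (|M| + 1))) := by
          refine hs'.tsum_le_tsum (fun k => ?_) (hyN.mul_right _)
          have := hN (k + N) (Nat.le_add_left N k)
          rw [dist_zero_right, Real.norm_eq_abs] at this
          rw [abs_mul]
          exact mul_le_mul_of_nonneg_left this.le (abs_nonneg _)
      _ ≤ |M| * (ε / (2 * (|M| + 1))) := by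
          rw [tsum_mul_right]
          refine mul_le_mul_of_nonneg_right ?_ (by positivity)
          have h1 := (Ell1.summable_abs (y i)).sum_add_tsum_nat_add N
          have h2 : 0 ≤ ∑ k ∈ Finset.range N, |y i k| := Finset.sum_nonneg fun _ _ => abs_nonneg _
          rw [← Ell1.norm_eq_tsum] at h1
          linarith [hM i, le_abs_self M]
      _ ≤ ε / 2 := by
          rw [mul_div_assoc', div_le_div_iff₀ (by positivity) (by positivity)]
          nlinarith [abs_nonneg M]
  rw [dist_zero_right, Real.norm_eq_abs] at hi ⊢
  rw [← hs.of_abs.sum_add_tsum_nat_add N]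
  linarith [abs_add_le (∑ k ∈ Finset.range N, y i k * u k) (∑' k, y i (k + N) * u (k + N))]

/-- Equality of the sums forces equality in every coordinate's triangle inequality. -/
theorem mul_nonneg_of_norm_add_eq {g h : Ell1} (hgh : ‖g + h‖ = ‖g‖ + ‖h‖) (k : ℕ) :
    0 ≤ g k * h k := by
  have hle (n : ℕ) : |(g + h) n| ≤ |g n| + |h n| := abs_add_le _ _
  have hs := (Ell1.summable_abs g).add (Ell1.summable_abs h)
  have heq : |g k + h k| = |g k| + |h k| := by
    by_contra hne
    have hlt : |(g + h) k| < |g k| + |h k| := lt_of_le_of_ne (hle k) hne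
    have := Summable.tsum_lt_tsum hle hlt (Ell1.summable_abs (g + h)) hs
    rw [(Ell1.summable_abs g).tsum_add (Ell1.summable_abs h), ← Ell1.norm_eq_tsum,
      ← Ell1.norm_eq_tsum, ← Ell1.norm_eq_tsum] at this
    linarith
  rcases (abs_add_eq_add_abs_iff _ _).1 heq with h | h
  · exact mul_nonneg h.1 h.2
  · exact mul_nonneg_of_nonpos_of_nonpos h.1 h.2

/-- A bounded family converging coordinatewise to `z` along an ultrafilter converges in
`σ(ℓ₁, W_f)` to `z + s • basisLimit f`, where `s` is the mass lost in the limit. -/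
theorem sigma_limit_eq (f : Ell1) (hf : ‖f‖ = 1) (hf0 : 1 / 2 ≤ |f 0|) {ι : Type*} {F : Filter ι}
    [F.NeBot] {x : ι → Ell1} {z g : Ell1} {M s : ℝ} (hM : ∀ i, ‖x i - z‖ ≤ M)
    (hz : ∀ k, Tendsto (fun i => (x i - z) k) F (𝓝 0))
    (hs : Tendsto (fun i => ∑' k, (x i - z) k) F (𝓝 s))
    (hg : Tendsto x F (@nhds Ell1 (sigmaTopology f) g)) : g = z + s • basisLimit f := by
  have hf0' : f 0 ≠ 0 := abs_pos.1 (by linarith)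
  refine eq_of_pairing_eq f hf hf0 fun w => ?_
  have h1 : Tendsto (fun i => pairing f (x i) w) F (𝓝 (pairing f g w)) :=
    ((@Continuous.tendsto _ _ (sigmaTopology f) _ _ (continuous_pairing f w)) g).comp hg
  have h2 : Tendsto (fun i => pairing f (x i) w) F
      (𝓝 (pairing f z w + (0 + s * seqLim w.1))) := by
    -- Split `w` into a null sequence and a constant: the first contributes nothing in the limit,
    -- the second contributes `s` times the limit of `w`.
    have hu : Tendsto (fun k => w.1.1 k - seqLim w.1) atTop (𝓝 0) := by
      simpa using (tendsto_seqLim w.1).sub_const (seqLim w.1)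
    refine (((tendsto_tsum_mul_zero hM hz hu).add (hs.mul_const _)).const_add _).congr fun i => ?_
    have h3 : pairing f (x i) w = pairing f z w + pairing f (x i - z) w := by
      rw [map_sub, LinearMap.sub_apply]
      ring
    have hsum : Summable fun k => (x i - z) k * (w.1.1 k - seqLim w.1) := by
      simp only [mul_sub]
      exact (summable_mul _ (summable_ell1 _) w.1.1).sub ((Ell1.summable _).mul_right _)
    rw [h3, pairing_apply f (x i - z), ← tsum_mul_right,
      ← hsum.tsum_add ((Ell1.summable _).mul_right _)]
    congr 1
    refine tsum_congr fun k => ?_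
    ring
  rw [tendsto_nhds_unique h1 h2, map_add, map_smul, LinearMap.add_apply, LinearMap.smul_apply,
    pairing_basisLimit f hf0', smul_eq_mul, zero_add]

/-! ### Sufficiency of the conditions. -/

theorem exists_fixedPoint_of_minimal (f : Ell1) (hf : ‖f‖ = 1) (hf0 : 1 / 2 ≤ |f 0|)
    (hcond : ‖basisLimit f‖ < 1 ∨ {n | 0 ≤ basisLimit f n}.Finite) {K : Set Ell1}
    (hne : K.Nonempty) (hK : @IsCompact Ell1 (sigmaTopology f) K) (hconv : Convex ℝ K)
    {T : Ell1 → Ell1} (hT : Set.MapsTo T K K) (hTn : ∀ x ∈ K, ∀ y ∈ K, ‖T x - T y‖ ≤ ‖x - y‖)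
    (hmin : ∀ K' ⊆ K, K'.Nonempty → @IsClosed Ell1 (sigmaTopology f) K' → Convex ℝ K' →
      Set.MapsTo T K' K' → K' = K) : ∃ x ∈ K, T x = x := by
  obtain ⟨M, hM⟩ := exists_norm_le_of_isCompact f hf hf0 hK
  have happ (n : ℕ) : ∃ x ∈ K, ‖x - T x‖ ≤ 1 / ((n : ℝ) + 1) :=
    exists_approx_fixedPoint hne hconv hM hT hTn (by positivity)
  choose x hxK hxT using happ
  let U : Ultrafilter ℕ := hyperfilter ℕ
  have hU : (U : Filter ℕ) ≤ atTop := Nat.hyperfilter_le_atTop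
  have hxT0 : Tendsto (fun n => ‖x n - T (x n)‖) U (𝓝 0) :=
    (squeeze_zero (fun _ => norm_nonneg _) hxT tendsto_one_div_add_atTop_nhds_zero_nat).mono_left hU
  obtain ⟨g, hgK, hg⟩ := @IsCompact.ultrafilter_le_nhds _ (sigmaTopology f) _ hK (U.map x)
    (by
      rw [Ultrafilter.coe_map, le_principal_iff]
      exact Filter.mem_map.2 (univ_mem' hxK))
  have hcoord (k : ℕ) : ∃ l, Tendsto (fun n => x n k) U (𝓝 l) :=
    exists_tendsto_of_abs_le U fun n =>
      (lp.norm_apply_le_norm one_ne_zero (x n) k).trans (hM _ (hxK n))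
  choose ζ hζ using hcoord
  let z : Ell1 := ⟨ζ, lp.memℓp_of_tendsto (F := x) (l := (U : Filter ℕ))
    (isBounded_iff_forall_norm_le.2 ⟨M, by rintro _ ⟨n, rfl⟩; exact hM _ (hxK n)⟩)
    (tendsto_pi_nhds.2 hζ)⟩
  have hz (k : ℕ) : Tendsto (fun n => (x n - z) k) U (𝓝 0) := by
    have := (hζ k).sub_const (ζ k)
    rwa [sub_self] at this
  have hMz (n : ℕ) : ‖x n - z‖ ≤ M + ‖z‖ :=
    (norm_sub_le _ _).trans (add_le_add_left (hM _ (hxK n)) _)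
  obtain ⟨s, hs⟩ := exists_tendsto_of_abs_le U
    (fun n => (Ell1.abs_tsum_le (x n - z)).trans (hMz n))
  have hgz : g = z + s • basisLimit f := sigma_limit_eq f hf hf0 hMz hz hs hg
  have hTz (y : Ell1) (hy : y ∈ K) : ‖z - T y‖ ≤ ‖z - y‖ := by
    have hlim (v : Ell1) : Tendsto (fun n => ‖x n - v‖ - ‖x n - z‖) U (𝓝 ‖z - v‖) := by
      rw [norm_sub_rev z v]
      refine (tendsto_norm_sub_sub_norm hz (v - z)).congr fun n => ?_
      rw [sub_sub_sub_cancel_right]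
    have h := (hlim y).add hxT0
    rw [add_zero] at h
    refine le_of_tendsto_of_tendsto (hlim (T y)) h (Eventually.of_forall fun n => ?_)
    have h1 := norm_sub_le_norm_sub_add_norm_sub (x n) (T (x n)) (T y)
    have h2 := hTn _ (hxK n) y hy
    change ‖x n - T y‖ - ‖x n - z‖ ≤ ‖x n - y‖ - ‖x n - z‖ + ‖x n - T (x n)‖
    linarith
  -- The part of `K` in a ball about `z` through a point of `K` is closed, convex and invariant,
  -- hence all of `K`.
  have hle (y v : Ell1) (hy : y ∈ K) (hv : v ∈ K) : ‖z - v‖ ≤ ‖z - y‖ := by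
    have hKeq : K ∩ {v | ‖z - v‖ ≤ ‖z - y‖} = K := by
      refine hmin _ Set.inter_subset_left ⟨y, hy, (le_rfl : ‖z - y‖ ≤ ‖z - y‖)⟩ ?_
        (hconv.inter ?_) ?_
      · have := t2Space_sigmaTopology f hf hf0
        exact @IsClosed.inter _ _ _ (sigmaTopology f) (@IsCompact.isClosed _ (sigmaTopology f) _ _ hK)
          (isClosed_sigma_closedBall f hf hf0 z _)
      · have : {v | ‖z - v‖ ≤ ‖z - y‖} = Metric.closedBall z ‖z - y‖ := by
          ext v
          rw [Metric.mem_closedBall', dist_eq_norm]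
          rfl
        rw [this]
        exact convex_closedBall _ _
      · rintro v ⟨hv, hvy⟩
        exact ⟨hT hv, (hTz v hv).trans hvy⟩
    exact (hKeq.symm ▸ hv : v ∈ K ∩ {v | ‖z - v‖ ≤ ‖z - y‖}).2
  have hconst (v : Ell1) (hv : v ∈ K) : ‖z - v‖ = |s| * ‖basisLimit f‖ := by
    rw [le_antisymm (hle g v hgK hv) (hle v g hv hgK), hgz, sub_add_cancel_left, norm_neg,
      norm_smul, Real.norm_eq_abs]
  have hxz (n : ℕ) : ‖x n - z‖ = |s| * ‖basisLimit f‖ := by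
    rw [norm_sub_rev, hconst _ (hxK n)]
  have hsle : |s| ≤ |s| * ‖basisLimit f‖ :=
    le_of_tendsto hs.abs (Eventually.of_forall fun n => hxz n ▸ Ell1.abs_tsum_le (x n - z))
  rcases eq_or_ne s 0 with rfl | hs0
  · have hz' (v : Ell1) (hv : v ∈ K) : z = v := by
      have := hconst v hv
      rwa [abs_zero, zero_mul, norm_eq_zero, sub_eq_zero] at this
    exact ⟨g, hgK, (hz' _ (hT hgK)).symm.trans (hz' _ hgK)⟩
  · exfalso
    have hspos : 0 < |s| := abs_pos.2 hs0
    have hfin : {n | 0 ≤ basisLimit f n}.Finite := by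
      refine hcond.resolve_left fun hlt => ?_
      nlinarith
    -- The midpoint of `g` and `x n` is as far from `z` as its endpoints, so the norms of `s •
    -- basisLimit f` and `x n - z` add.
    have hsign (n k : ℕ) : 0 ≤ (s • basisLimit f) k * (x n - z) k := by
      refine mul_nonneg_of_norm_add_eq ?_ k
      have hmid := hconst _ (hconv hgK (hxK n) (a := 1 / 2) (b := 1 / 2) (by norm_num)
        (by norm_num) (by norm_num))
      have heq : z - ((1 / 2 : ℝ) • g + (1 / 2 : ℝ) • x n) =
          (-(1 / 2) : ℝ) • (s • basisLimit f + (x n - z)) := by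
        rw [hgz]
        module
      rw [heq, norm_smul, Real.norm_eq_abs, abs_neg, abs_of_pos (by norm_num)] at hmid
      rw [hxz n, norm_smul s, Real.norm_eq_abs]
      linarith
    have hneg (n k : ℕ) (hk : k ∉ hfin.toFinset) : s * (x n - z) k ≤ 0 := by
      rw [hfin.mem_toFinset] at hk
      have hk' : basisLimit f k < 0 := not_le.1 hk
      have h := hsign n k
      have h' : (s • basisLimit f) k * (x n - z) k = basisLimit f k * (s * (x n - z) k) := by
        change (s * basisLimit f k) * _ = _
        ring
      rw [h'] at h
      by_contra! hpos
      linarith [mul_neg_of_neg_of_pos hk' hpos]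
    -- Dropping the nonpositive terms leaves a finite sum tending to zero, while the left side tends
    -- to `s * s > 0`.
    have hsum (n : ℕ) : s * ∑' k, (x n - z) k ≤ ∑ k ∈ hfin.toFinset, s * (x n - z) k := by
      rw [← tsum_mul_left]
      have hS := (Ell1.summable (x n - z)).mul_left s
      have h := (hS.neg.sum_le_tsum hfin.toFinset fun k hk => neg_nonneg.2 (hneg n k hk))
      rw [tsum_neg, Finset.sum_neg_distrib] at h
      linarith
    have h1 : Tendsto (fun n => ∑ k ∈ hfin.toFinset, s * (x n - z) k) U (𝓝 0) := by
      simpa using tendsto_finsetSum hfin.toFinset fun k _ => (hz k).const_mul s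
    have h2 := le_of_tendsto_of_tendsto (hs.const_mul s) h1 (Eventually.of_forall hsum)
    exact absurd h2 (not_le.2 (mul_self_pos.2 hs0))

theorem hasSigmaFPP_of_basisLimit (f : Ell1) (hf : ‖f‖ = 1) (hf0 : 1 / 2 ≤ |f 0|)
    (hcond : ‖basisLimit f‖ < 1 ∨ {n | 0 ≤ basisLimit f n}.Finite) : HasSigmaFPP f := by
  classical
  intro C hne hconv hC T hT
  -- The value off `C` is arbitrary; only the restriction to `C` enters.
  let T' (x : Ell1) : Ell1 := if h : x ∈ C then T ⟨x, h⟩ else x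
  have hT' (x : Ell1) (h : x ∈ C) : T' x = T ⟨x, h⟩ := dif_pos h
  have hmaps : Set.MapsTo T' C C := fun x hx => by
    rw [hT' x hx]
    exact (T ⟨x, hx⟩).2
  obtain ⟨K, hKC, hKne, hKcomp, hKconv, hKT, hmin⟩ := @exists_minimal_invariant Ell1 _ _
    (sigmaTopology f) (t2Space_sigmaTopology f hf hf0) C hne hconv hC T' hmaps
  obtain ⟨x, hx, hfix⟩ := exists_fixedPoint_of_minimal f hf hf0 hcond hKne hKcomp hKconv hKT
    (fun x hx y hy => by
      rw [hT' x (hKC hx), hT' y (hKC hy)]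
      exact hT _ _) hmin
  exact ⟨⟨x, hKC hx⟩, Subtype.ext ((hT' x (hKC hx)).symm.trans hfix)⟩

/-! ### Copies of `ℓ₁` on a subsequence of coordinates. -/

theorem hasSum_extend {ν : ℕ → ℕ} (hν : ν.Injective) {m : ℕ → ℝ} (hm : Summable m) :
    HasSum (Function.extend ν m 0) (∑' k, m k) :=
  (hasSum_extend_zero hν).2 hm.hasSum

/-- The isometry of `ℓ₁` sending the `k`-th basis vector to the `ν k`-th one. -/
def spread {ν : ℕ → ℕ} (hν : ν.Injective) (m : Ell1) : Ell1 :=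
  Ell1.mk (Function.extend ν m 0) (by
    have h : (fun n => |Function.extend ν m 0 n|) = Function.extend ν (fun k => |m k|) 0 := by
      ext n
      by_cases hn : ∃ k, ν k = n
      · obtain ⟨k, rfl⟩ := hn
        simp [hν.extend_apply]
      · simp [Function.extend_apply' _ _ _ hn]
    rw [h]
    exact (hasSum_extend hν (Ell1.summable_abs m)).summable)

section spread

variable {ν : ℕ → ℕ} (hν : ν.Injective)

theorem spread_apply (m : Ell1) (k : ℕ) : spread hν m (ν k) = m k := hν.extend_apply _ _ k

theorem spread_apply_of_notMem (m : Ell1) {n : ℕ} (hn : ¬∃ k, ν k = n) : spread hν m n = 0 :=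
  Function.extend_apply' _ _ _ hn

/-- A sum over the support of `spread hν m`. -/
theorem tsum_spread (m : Ell1) (φ : ℕ → ℝ → ℝ) (hφ : ∀ n, φ n 0 = 0)
    (hs : Summable fun k => φ (ν k) (m k)) :
    ∑' n, φ n (spread hν m n) = ∑' k, φ (ν k) (m k) := by
  rw [← (hasSum_extend hν hs).tsum_eq]
  refine tsum_congr fun n => ?_
  by_cases hn : ∃ k, ν k = n
  · obtain ⟨k, rfl⟩ := hn
    rw [hν.extend_apply, spread_apply]
  · rw [Function.extend_apply' _ _ _ hn, spread_apply_of_notMem hν m hn, hφ]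
    rfl

theorem norm_spread (m : Ell1) : ‖spread hν m‖ = ‖m‖ := by
  rw [Ell1.norm_eq_tsum, Ell1.norm_eq_tsum]
  exact tsum_spread hν m (fun _ t => |t|) (fun _ => abs_zero) (Ell1.summable_abs m)

theorem spread_add (m m' : Ell1) : spread hν (m + m') = spread hν m + spread hν m' := by
  ext n
  by_cases hn : ∃ k, ν k = n
  · obtain ⟨k, rfl⟩ := hn
    simp [spread_apply]
  · simp [spread_apply_of_notMem hν _ hn]

theorem spread_smul (r : ℝ) (m : Ell1) : spread hν (r • m) = r • spread hν m := by
  ext n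
  by_cases hn : ∃ k, ν k = n
  · obtain ⟨k, rfl⟩ := hn
    simp [spread_apply]
  · simp [spread_apply_of_notMem hν _ hn]

theorem spread_sub (m m' : Ell1) : spread hν (m - m') = spread hν m - spread hν m' := by
  have h := spread_add hν (m - m') m'
  rw [sub_add_cancel] at h
  rw [h, add_sub_cancel_right]

theorem pairing_spread (f m : Ell1) (w : W f) :
    pairing f (spread hν m) w = ∑' k, m k * w.1.1 (ν k) := by
  refine tsum_spread hν m (fun n t => t * w.1.1 n) (fun n => zero_mul _) ?_
  refine ((Ell1.summable_abs m).mul_right ‖w.1.1‖).of_norm_bounded fun k => ?_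
  rw [norm_mul]
  exact mul_le_mul_of_nonneg_left (lp.norm_apply_le_norm (by simp) w.1.1 _) (norm_nonneg _)

/-- The subsequence of `x` along `ν`. -/
def subseq (x : Ell1) : Ell1 :=
  Ell1.mk (fun k => x (ν k)) ((Ell1.summable_abs x).comp_injective hν)

theorem subseq_apply (x : Ell1) (k : ℕ) : subseq hν x k = x (ν k) := rfl

theorem subseq_sub (x y : Ell1) : subseq hν (x - y) = subseq hν x - subseq hν y := rfl

theorem norm_eq_norm_subseq_add (x : Ell1) :
    ‖x‖ = ‖subseq hν x‖ + ‖x - spread hν (subseq hν x)‖ := by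
  rw [← norm_spread hν (subseq hν x), Ell1.norm_eq_tsum, Ell1.norm_eq_tsum, Ell1.norm_eq_tsum,
    ← (Ell1.summable_abs _).tsum_add (Ell1.summable_abs _)]
  refine tsum_congr fun n => ?_
  change _ = _ + |x n - spread hν (subseq hν x) n|
  by_cases hn : ∃ k, ν k = n
  · obtain ⟨k, rfl⟩ := hn
    simp [spread_apply, subseq_apply]
  · simp [spread_apply_of_notMem hν _ hn]

/-! ### A compact convex set built from `e` and basis vectors. -/

/-- The nonnegative elements of `ℓ₁` of mass at most one. -/
def subSimplex : Set Ell1 := {m | (∀ k, 0 ≤ m k) ∧ ∑' k, m k ≤ 1}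

/-- The coefficients `m` put mass `m k` on the `ν k`-th basis vector and the rest on `e`. -/
def fillUp (e m : Ell1) : Ell1 := (1 - ∑' k, m k) • e + spread hν m

theorem convex_fillUp_image (e : Ell1) : Convex ℝ (fillUp hν e '' subSimplex) := by
  rintro _ ⟨m, ⟨hm0, hm1⟩, rfl⟩ _ ⟨m', ⟨hm0', hm1'⟩, rfl⟩ a b ha hb hab
  have hsum : ∑' k, (a • m + b • m') k = a * ∑' k, m k + b * ∑' k, m' k := by
    rw [← tsum_mul_left, ← tsum_mul_left,
      ← ((Ell1.summable m).mul_left a).tsum_add ((Ell1.summable m').mul_left b)]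
    rfl
  refine ⟨a • m + b • m', ⟨fun k => ?_, ?_⟩, ?_⟩
  · exact add_nonneg (mul_nonneg ha (hm0 k)) (mul_nonneg hb (hm0' k))
  · rw [hsum]
    nlinarith
  · simp only [fillUp]
    rw [hsum, spread_add, spread_smul, spread_smul]
    obtain rfl : b = 1 - a := by linarith
    module

/-- The sequences underlying `subSimplex`. -/
def subSimplexSeq : Set (ℕ → ℝ) :=
  {m | (∀ k, 0 ≤ m k) ∧ ∀ N, ∑ k ∈ Finset.range N, m k ≤ 1}

theorem isCompact_subSimplexSeq : IsCompact subSimplexSeq := by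
  refine (isCompact_univ_pi fun _ : ℕ => isCompact_Icc (a := (0 : ℝ)) (b := 1)).of_isClosed_subset
    ?_ fun m hm k _ => ⟨hm.1 k, ?_⟩
  · have h : subSimplexSeq = (⋂ k, {m : ℕ → ℝ | 0 ≤ m k}) ∩
        ⋂ N, {m : ℕ → ℝ | ∑ k ∈ Finset.range N, m k ≤ 1} := by
      ext m
      simp [subSimplexSeq]
    rw [h]
    exact (isClosed_iInter fun k => isClosed_le continuous_const (continuous_apply k)).inter
      (isClosed_iInter fun N =>
        isClosed_le (continuous_finsetSum _ fun k _ => continuous_apply k) continuous_const)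
  · exact (Finset.single_le_sum (fun j _ => hm.1 j) (Finset.self_mem_range_succ k)).trans
      (hm.2 (k + 1))

theorem summable_of_mem_subSimplexSeq {m : ℕ → ℝ} (hm : m ∈ subSimplexSeq) :
    Summable fun k => |m k| := by
  simp only [abs_of_nonneg (hm.1 _)]
  exact summable_of_sum_range_le hm.1 hm.2

/-- The parameter set is compact in the product topology. Pairing with `w` gives its limit plus `∑ m
k * u k` with `u` null, which is continuous there although the total mass is not. -/
theorem isCompact_fillUp_image (f : Ell1) (hf0 : f 0 ≠ 0) (hν' : Tendsto ν atTop atTop) :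
    @IsCompact Ell1 (sigmaTopology f) (fillUp hν (basisLimit f) '' subSimplex) := by
  let ψ (m : subSimplexSeq) : Ell1 := Ell1.mk m.1 (summable_of_mem_subSimplexSeq m.2)
  have hψ (m : subSimplexSeq) : ψ m ∈ subSimplex :=
    ⟨m.2.1, Real.tsum_le_of_sum_range_le m.2.1 m.2.2⟩
  have himage : fillUp hν (basisLimit f) '' subSimplex =
      Set.range fun m => fillUp hν (basisLimit f) (ψ m) := by
    ext x
    constructor
    · rintro ⟨m, hm, rfl⟩
      exact ⟨⟨fun k => m k, hm.1, fun N =>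
        ((Ell1.summable m).sum_le_tsum _ fun k _ => hm.1 k).trans hm.2⟩, rfl⟩
    · rintro ⟨m, rfl⟩
      exact ⟨ψ m, hψ m, rfl⟩
  have : CompactSpace subSimplexSeq := isCompact_iff_compactSpace.1 isCompact_subSimplexSeq
  rw [himage]
  refine @isCompact_range _ _ _ (sigmaTopology f) _ _
    (WeakBilin.continuous_of_continuous_eval (pairing f) fun w => ?_)
  let u (k : ℕ) : ℝ := w.1.1 (ν k) - seqLim w.1
  have hu : Tendsto u atTop (𝓝 0) := by
    simpa using ((tendsto_seqLim w.1).comp hν').sub_const (seqLim w.1)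
  have hsw (m : Ell1) : Summable fun k => m k * w.1.1 (ν k) := by
    refine ((Ell1.summable_abs m).mul_right ‖w.1.1‖).of_norm_bounded fun k => ?_
    rw [norm_mul]
    exact mul_le_mul_of_nonneg_left (lp.norm_apply_le_norm (by simp) w.1.1 _) (norm_nonneg _)
  have hsu (m : Ell1) : Summable fun k => m k * u k := by
    simp only [u, mul_sub]
    exact (hsw m).sub ((Ell1.summable m).mul_right _)
  have heval (m : Ell1) :
      pairing f (fillUp hν (basisLimit f) m) w = seqLim w.1 + ∑' k, m k * u k := by
    have h1 : ∑' k, m k * u k = ∑' k, m k * w.1.1 (ν k) - (∑' k, m k) * seqLim w.1 := by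
      rw [← tsum_mul_right, ← (hsw m).tsum_sub ((Ell1.summable m).mul_right _)]
      exact tsum_congr fun k => mul_sub _ _ _
    rw [fillUp, map_add, map_smul, LinearMap.add_apply, LinearMap.smul_apply,
      pairing_basisLimit f hf0, pairing_spread, smul_eq_mul, h1]
    ring
  suffices h : Continuous fun m => ∑' k, ψ m k * u k from
    (continuous_const.add h).congr fun m => (heval (ψ m)).symm
  refine continuous_iff_continuousAt.2 fun m₀ => ?_
  have hnorm (m : subSimplexSeq) : ‖ψ m‖ ≤ 1 := by
    rw [Ell1.norm_eq_tsum]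
    exact (tsum_congr fun k => abs_of_nonneg (m.2.1 k)).trans_le (hψ m).2
  have hlim : Tendsto (fun m => ∑' k, (ψ m - ψ m₀) k * u k) (𝓝 m₀) (𝓝 0) := by
    refine tendsto_tsum_mul_zero (M := 1 + 1)
      (fun m => (norm_sub_le _ _).trans (add_le_add (hnorm m) (hnorm m₀))) (fun k => ?_) hu
    have h : Continuous fun m : subSimplexSeq => m.1 k - m₀.1 k :=
      ((continuous_apply k).comp continuous_subtype_val).sub continuous_const
    have h' := h.tendsto m₀
    rwa [sub_self] at h'
  have h := hlim.add_const (∑' k, ψ m₀ k * u k)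
  rw [zero_add] at h
  refine h.congr fun m => ?_
  rw [← (hsu (ψ m - ψ m₀)).tsum_add (hsu (ψ m₀))]
  refine tsum_congr fun k => ?_
  change (ψ m k - ψ m₀ k) * u k + _ = _
  ring

/-! ### Necessity: the shift without fixed points. -/

/-- Prepend an entry so that the total mass becomes one. -/
def prependMass (m : Ell1) : Ell1 :=
  Ell1.mk (fun k => if k = 0 then 1 - ∑' j, m j else m (k - 1)) (by
    refine (summable_nat_add_iff 1).1 ?_
    simpa using Ell1.summable_abs m)

theorem prependMass_zero (m : Ell1) : prependMass m 0 = 1 - ∑' j, m j := by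
  simp [prependMass]

theorem prependMass_succ (m : Ell1) (k : ℕ) : prependMass m (k + 1) = m k := by
  simp [prependMass]

theorem tsum_prependMass (m : Ell1) : ∑' k, prependMass m k = 1 := by
  rw [(Ell1.summable (prependMass m)).tsum_eq_zero_add, prependMass_zero]
  simp only [prependMass_succ, sub_add_cancel]

theorem norm_prependMass_sub (m m' : Ell1) :
    ‖prependMass m - prependMass m'‖ = |∑' k, m k - ∑' k, m' k| + ‖m - m'‖ := by
  rw [Ell1.norm_eq_abs_add, Ell1.norm_eq_tsum (m - m')]
  congr 1
  change |1 - ∑' k, m k - (1 - ∑' k, m' k)| = _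
  rw [sub_sub_sub_cancel_left, abs_sub_comm]

end spread

/-- `σ(ℓ₁, W_f)`-FPP fails when the limit of the basis has norm one and is nonnegative along a
subsequence. -/
theorem not_hasSigmaFPP {ν : ℕ → ℕ} (hν : ν.Injective) (f : Ell1) (hf0 : f 0 ≠ 0)
    (he : ‖basisLimit f‖ = 1) (hν' : Tendsto ν atTop atTop) (hpos : ∀ k, 0 ≤ basisLimit f (ν k)) : ¬HasSigmaFPP f := by
  intro hFPP
  set e := basisLimit f
  let C : Set Ell1 := fillUp hν e '' subSimplex
  let δ := ∑' k, subseq hν e k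
  have hδ : ‖subseq hν e‖ = δ := by
    rw [Ell1.norm_eq_tsum]
    exact tsum_congr fun k => abs_of_nonneg (hpos k)
  have hrest : ‖e - spread hν (subseq hν e)‖ = 1 - δ := by
    have := norm_eq_norm_subseq_add hν e
    rw [he, hδ] at this
    linarith
  have hδ1 : 0 ≤ 1 - δ := hrest ▸ norm_nonneg _
  have hsub (m : Ell1) : subseq hν (fillUp hν e m) = (1 - ∑' k, m k) • subseq hν e + m := by
    ext k
    change (1 - ∑' k, m k) * e (ν k) + spread hν m (ν k) = (1 - ∑' k, m k) * e (ν k) + m k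
    rw [spread_apply]
  -- The mass missing on the subsequence is what `e` carries off it in norm; this is why `‖e‖ = 1`
  -- is needed.
  have hmass (m : Ell1) : 1 - ∑' k, subseq hν (fillUp hν e m) k = (1 - ∑' k, m k) * (1 - δ) := by
    have h : ∑' k, subseq hν (fillUp hν e m) k = (1 - ∑' k, m k) * δ + ∑' k, m k := by
      rw [hsub, ← tsum_mul_left,
        ← ((Ell1.summable (subseq hν e)).mul_left _).tsum_add (Ell1.summable m)]
      rfl
    rw [h]
    ring
  have hTC (x : Ell1) (hx : x ∈ C) : spread hν (prependMass (subseq hν x)) ∈ C := by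
    obtain ⟨m, ⟨hm0, hm1⟩, rfl⟩ := hx
    refine ⟨prependMass (subseq hν (fillUp hν e m)), ⟨fun k => ?_, (tsum_prependMass _).le⟩, ?_⟩
    · cases k with
      | zero =>
        rw [prependMass_zero, hmass]
        exact mul_nonneg (by linarith) hδ1
      | succ k =>
        rw [prependMass_succ, hsub]
        exact add_nonneg (mul_nonneg (by linarith) (hpos k)) (hm0 k)
    · rw [fillUp, tsum_prependMass, sub_self, zero_smul, zero_add]
  let T (x : C) : C := ⟨spread hν (prependMass (subseq hν x)), hTC x x.2⟩
  have hT (x y : C) : ‖(T x : Ell1) - T y‖ ≤ ‖(x : Ell1) - y‖ := by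
    obtain ⟨_, m, hm, rfl⟩ := x
    obtain ⟨_, m', hm', rfl⟩ := y
    change ‖spread hν _ - spread hν _‖ ≤ ‖fillUp hν e m - fillUp hν e m'‖
    rw [← spread_sub, norm_spread, norm_prependMass_sub, norm_eq_norm_subseq_add hν (fillUp hν e m - _),
      subseq_sub, add_comm]
    -- The change in the prepended entry equals the norm of the difference off the subsequence, so
    -- `T` is even isometric.
    refine add_le_add_right (le_of_eq ?_) _
    have h1 : ∑' k, subseq hν (fillUp hν e m) k - ∑' k, subseq hν (fillUp hν e m') k =
        (∑' k, m k - ∑' k, m' k) * (1 - δ) := by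
      linear_combination hmass m' - hmass m
    have h2 : fillUp hν e m - fillUp hν e m' -
        spread hν (subseq hν (fillUp hν e m) - subseq hν (fillUp hν e m')) =
        (∑' k, m' k - ∑' k, m k) • (e - spread hν (subseq hν e)) := by
      rw [hsub, hsub, spread_sub, spread_add, spread_add, spread_smul, spread_smul, fillUp, fillUp]
      module
    rw [h1, h2, norm_smul, hrest, abs_mul, abs_of_nonneg hδ1, Real.norm_eq_abs, abs_sub_comm]
  obtain ⟨x, hx⟩ := hFPP C
    ⟨_, 0, ⟨fun _ => le_rfl, by simp⟩, rfl⟩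
    (convex_fillUp_image hν e) (isCompact_fillUp_image hν f hf0 hν') T hT
  have hfix : spread hν (prependMass (subseq hν x)) = (x : Ell1) := congrArg Subtype.val hx
  have hcoord (k : ℕ) : prependMass (subseq hν x) k = subseq hν x k := by
    rw [← spread_apply hν (prependMass (subseq hν x)) k, hfix, subseq_apply]
  -- A point fixed by the shift is constant along `ν`, hence zero by summability, yet its first
  -- entry must then be `1`.
  have hconst (k : ℕ) : subseq hν x k = subseq hν x 0 := by
    induction k with
    | zero => rfl
    | succ k ih => rw [← hcoord (k + 1), prependMass_succ, ih]
  have hzero : subseq hν x 0 = 0 := by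
    have h := (Ell1.summable (subseq hν x)).tendsto_atTop_zero
    simp only [hconst] at h
    exact tendsto_nhds_unique tendsto_const_nhds h
  have h := hcoord 0
  rw [prependMass_zero, tsum_congr fun k => (hconst k).trans hzero, tsum_zero, hzero] at h
  norm_num at h

end

end WeakStarFPP

theorem proposition2p2 (f : WeakStarFPP.Ell1) (hf : ‖f‖ = 1)
    (hf_ge : 1 / 2 ≤ |f 0|) (hf_lt : |f 0| < 1)
    (hf_tail : ∀ j : ℕ, 1 ≤ j → |f j| < 1 / 2) :
    WeakStarFPP.HasSigmaFPP f ↔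
      (1 / 2 < |f 0| ∨ (|f 0| = 1 / 2 ∧ {n : ℕ | f 0 * f (n + 1) ≤ 0}.Finite)) := by
  have hpos : 0 < |f 0| := by linarith
  have hf0 : f 0 ≠ 0 := abs_pos.1 hpos
  have hset : {n : ℕ | f 0 * f (n + 1) ≤ 0} = {n | 0 ≤ WeakStarFPP.basisLimit f n} := by
    ext n
    exact (WeakStarFPP.basisLimit_nonneg_iff f hf0 n).symm
  rw [hset]
  constructor
  · intro h
    rcases hf_ge.lt_or_eq with hlt | heq
    · exact Or.inl hlt
    · refine Or.inr ⟨heq.symm, ?_⟩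
      by_contra hinf
      have hinf : {n | 0 ≤ WeakStarFPP.basisLimit f n}.Infinite := hinf
      -- The increasing enumeration of the infinite set of nonnegative entries supplies `ν`.
      have hmono := Nat.nth_strictMono hinf
      refine WeakStarFPP.not_hasSigmaFPP hmono.injective f hf0 ?_ hmono.tendsto_atTop
        (fun k => Nat.nth_mem_of_infinite hinf k) h
      rw [WeakStarFPP.norm_basisLimit f hf, ← heq]
      norm_num
  · intro h
    refine WeakStarFPP.hasSigmaFPP_of_basisLimit f hf hf_ge (h.imp (fun hlt => ?_) And.right)
    rw [WeakStarFPP.norm_basisLimit f hf, div_lt_one hpos]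
    linarith
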